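/- Let $G$ be a locally compact, $\sigma$-compact, metrizable topological group that is a finite extension of a nilpotent group, i.e. $G$ has a nilpotent subgroup of finite index. Then $G$ is identity excluding: there is no non-trivial irreducible unitary representation $T$ of $G$ on a complex Hilbert space $\mathcal H$ for which there exist a dense subgroup $D$ of $G$ and a sequence $(v_n)$ of unit vectors in $\mathcal H$ with $\|T(g)v_n - v_n\| \to 0$ for every $g \in D$. Here a unitary representation is a homomorphism $T$ from $G$ to the unitary operators of $\mathcal H$ such that $g \mapsto T(g)v$ is continuous for each $v \in \mathcal H$; it is irreducible if $\mathcal H \neq 0$ and the only closed $T(G)$-invariant subspaces are $0$ and $\mathcal H$, and an irreducible $T$ is non-trivial if $T(g) \neq 1$ for some $g \in G$. -/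

import Mathlib

open Filter Topology

universe u v

/-- A unitary representation of a topological group `G` in a complex Hilbert space `H`: a
homomorphism into the unitary operators of `H` whose orbit maps `g ↦ T g v` are continuous. -/
structure UnitaryRep (G : Type*) [Group G] [TopologicalSpace G]
    (H : Type*) [NormedAddCommGroup H] [InnerProductSpace ℂ H] [CompleteSpace H] where
  /-- The underlying homomorphism into the unitary group of `H`. -/
  toHom : G →* unitary (H →L[ℂ] H)
  continuous_orbit : ∀ v : H, Continuous fun g : G => (toHom g : H →L[ℂ] H) v

namespace UnitaryRep

/-- The operator by which `g` acts. -/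
noncomputable def op {G : Type*} [Group G] [TopologicalSpace G]
    {H : Type*} [NormedAddCommGroup H] [InnerProductSpace ℂ H] [CompleteSpace H]
    (T : UnitaryRep G H) (g : G) : H →L[ℂ] H :=
  (T.toHom g : H →L[ℂ] H)

/-- The restriction `T|_D` of `T` to a subgroup `D` (with the subspace topology). -/
noncomputable def restrict {G : Type*} [Group G] [TopologicalSpace G]
    {H : Type*} [NormedAddCommGroup H] [InnerProductSpace ℂ H] [CompleteSpace H]
    (T : UnitaryRep G H) (D : Subgroup G) : UnitaryRep D H where
  toHom := T.toHom.comp D.subtype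
  continuous_orbit v := (T.continuous_orbit v).comp continuous_subtype_val

/-- `T` is irreducible: `H` is nonzero, and the only closed `T(G)`-invariant subspaces of `H`
are `0` and `H`. -/
def IsIrreducible {G : Type*} [Group G] [TopologicalSpace G]
    {H : Type*} [NormedAddCommGroup H] [InnerProductSpace ℂ H] [CompleteSpace H]
    (T : UnitaryRep G H) : Prop :=
  Nontrivial H ∧
    ∀ V : Submodule ℂ H, IsClosed (V : Set H) → (∀ g : G, ∀ v ∈ V, T.op g v ∈ V) →
      V = ⊥ ∨ V = ⊤

/-- Every group element acts as the identity. An irreducible representation has this property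
exactly when it is (equivalent to) the trivial irreducible representation `I`. -/
def IsTrivial {G : Type*} [Group G] [TopologicalSpace G]
    {H : Type*} [NormedAddCommGroup H] [InnerProductSpace ℂ H] [CompleteSpace H]
    (T : UnitaryRep G H) : Prop :=
  ∀ (g : G) (v : H), T.op g v = v

/-- `I ≺ T`: there is a sequence of unit vectors `v n` (an approximate fixed point) such that
`‖T g (v n) - v n‖ → 0` for every `g`. -/
def WeaklyContainsTrivial {G : Type*} [Group G] [TopologicalSpace G]
    {H : Type*} [NormedAddCommGroup H] [InnerProductSpace ℂ H] [CompleteSpace H]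
    (T : UnitaryRep G H) : Prop :=
  ∃ v : ℕ → H, (∀ n, ‖v n‖ = 1) ∧
    ∀ g : G, Tendsto (fun n => ‖T.op g (v n) - v n‖) atTop (𝓝 0)

end UnitaryRep

/-- `G` is identity excluding: there is no non-trivial irreducible unitary representation `T` of
`G` for which some dense subgroup `D` of `G` satisfies `I ≺ T|_D`. -/
def IdentityExcluding (G : Type u) [Group G] [TopologicalSpace G] : Prop :=
  ∀ (H : Type v) [NormedAddCommGroup H] [InnerProductSpace ℂ H] [CompleteSpace H]
    (T : UnitaryRep G H), T.IsIrreducible → ¬ T.IsTrivial →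
      ¬ ∃ D : Subgroup G, Dense (D : Set G) ∧ (T.restrict D).WeaklyContainsTrivial

/-!
The group `D` meets the nilpotent finite-index subgroup in a nilpotent subgroup of finite index,
and `T` restricted to the dense subgroup `D` is still irreducible, so only the abstract group `D`
matters: an irreducible representation of a virtually nilpotent group with an approximate fixed
point is trivial.

The engine is `UnitaryRep.IsIrreducible.op_eq_one_of_finite_conj`: if `T` is irreducible with an
approximate fixed point `v` and the operators `T (d * a * d⁻¹)` form a finite set, then
`T a = 1`. The operator `A = ∑ (U - 1)* (U - 1)`, summed over this finite set, is self-adjoint,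
commutes with `T` and satisfies `A (v n) → 0`. By Schur's lemma, in the form
`UnitaryRep.IsIrreducible.eq_zero_of_tendsto`, `A = 0`; as every summand is positive, each `U`
in the set is the identity.

Let `M` be nilpotent of finite index. If `T` is trivial on the `n`-th term of the upper central
series of `M` and `a` lies in the next one, then `T (d * a * d⁻¹)` depends only on the coset `d M`,
so `T a = 1`. Hence `T` is trivial on `M`; then `T` has finite image and the same argument applies
to every element.
-/

namespace UnitaryRep

variable {G : Type*} [Group G] [TopologicalSpace G]
  {H : Type*} [NormedAddCommGroup H] [InnerProductSpace ℂ H] [CompleteSpace H]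
  {T : UnitaryRep G H}

lemma coe_toHom (T : UnitaryRep G H) (g : G) : (T.toHom g : H →L[ℂ] H) = T.op g := rfl

lemma op_eq_one_iff {g : G} : T.op g = 1 ↔ T.toHom g = 1 := by
  rw [← coe_toHom]; exact OneMemClass.coe_eq_one

/-- A closed subspace invariant under a dense subgroup is invariant under the whole group. -/
theorem IsIrreducible.restrict_of_dense (hT : T.IsIrreducible) {D : Subgroup G}
    (hD : Dense (D : Set G)) : (T.restrict D).IsIrreducible := by
  refine ⟨hT.1, fun V hV hinv => hT.2 V hV fun g v hv => ?_⟩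
  have hclosed : IsClosed {g : G | T.op g v ∈ V} := hV.preimage (T.continuous_orbit v)
  exact hclosed.closure_subset_iff.2 (fun d hd => hinv ⟨d, hd⟩ v hv) (hD g)

lemma IsIrreducible.eq_zero_of_mul_eq_zero (hT : T.IsIrreducible) {B C : H →L[ℂ] H}
    (hB : ∀ g, Commute B (T.op g)) (h : B * C = 0) : B = 0 ∨ C = 0 := by
  rcases hT.2 (LinearMap.ker B.toLinearMap) B.isClosed_ker (fun g v hv => by
    have hv' : B v = 0 := hv
    change B (T.op g v) = 0
    simpa [hv'] using congrArg (fun S : H →L[ℂ] H => S v) (hB g).eq) with h0 | h0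
  · right
    ext v
    have : C v ∈ LinearMap.ker B.toLinearMap := congrArg (fun S : H →L[ℂ] H => S v) h
    simpa [h0] using this
  · left
    ext v
    have : v ∈ LinearMap.ker B.toLinearMap := h0 ▸ Submodule.mem_top
    exact this

/-- A self-adjoint intertwiner of an irreducible representation is semidefinite, since its positive
and negative parts are intertwiners with product zero. Applied to the shifts of an operator by real
scalars, this stands in for the statement that the operator is a scalar. -/
theorem IsIrreducible.nonpos_or_nonneg (hT : T.IsIrreducible) {A : H →L[ℂ] H}
    (hA : IsSelfAdjoint A) (hc : ∀ g, Commute A (T.op g)) : A ≤ 0 ∨ 0 ≤ A := by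
  rcases hT.eq_zero_of_mul_eq_zero (B := A⁺) (C := A⁻)
    (fun g => (hc g).cfcₙ_real _) (CFC.posPart_mul_negPart A) with h | h
  · exact .inl ((CFC.posPart_eq_zero_iff A hA).1 h)
  · exact .inr ((CFC.negPart_eq_zero_iff A hA).1 h)

/-- For `ε > 0` the shift `A - ε` is semidefinite; it cannot be nonnegative, because `0` is an
approximate eigenvalue of `A`. Hence `A ≤ ε` for all `ε > 0`. -/
lemma IsIrreducible.nonpos_of_tendsto (hT : T.IsIrreducible) {A : H →L[ℂ] H}
    (hA : IsSelfAdjoint A) (hc : ∀ g, Commute A (T.op g)) {v : ℕ → H} (hv : ∀ n, ‖v n‖ = 1)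
    (hlim : Tendsto (fun n => A (v n)) atTop (𝓝 0)) : A ≤ 0 := by
  have key : ∀ ε : ℝ, 0 < ε → ∀ x : H, RCLike.re (inner ℂ (A x) x) ≤ ε * ‖x‖ ^ 2 := by
    intro ε hε x
    set E : H →L[ℂ] H := algebraMap ℝ (H →L[ℂ] H) ε with hE
    have hre : ∀ y, RCLike.re (inner ℂ ((A - E) y) y)
        = RCLike.re (inner ℂ (A y) y) - ε * ‖y‖ ^ 2 := by
      intro y
      have : E y = (ε : ℂ) • y := by
        simp [hE, Algebra.algebraMap_eq_smul_one]
      rw [sub_apply, this, inner_sub_left, inner_smul_left, map_sub,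
        inner_self_eq_norm_sq_to_K]
      congr 1
      simp only [Complex.conj_ofReal, Complex.coe_algebraMap]
      norm_cast
    rcases hT.nonpos_or_nonneg (A := A - E)
      (hA.sub (.algebraMap _ (.all ε)))
      (fun g => (hc g).sub_left (Algebra.commute_algebraMap_left ε _)) with h | h
    · have h1 := ((ContinuousLinearMap.le_def _ _).1 h).re_inner_nonneg_left x
      simp only [zero_sub, neg_apply, inner_neg_left, map_neg, hre] at h1
      linarith
    · exfalso
      -- `⟪A (v n), v n⟫ → 0`, although it is at least `ε` for every `n`.
      have h2 : ∀ n, ε ≤ ‖A (v n)‖ := fun n => by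
        have h1 := ((ContinuousLinearMap.nonneg_iff_isPositive _).1 h).re_inner_nonneg_left (v n)
        have h3 := re_inner_le_norm (𝕜 := ℂ) (A (v n)) (v n)
        rw [hre] at h1
        rw [hv n] at h1 h3
        linarith
      have h3 : ε ≤ 0 := ge_of_tendsto' (by simpa using hlim.norm) h2
      linarith
  rw [← neg_nonneg, ContinuousLinearMap.nonneg_iff_isPositive,
    ContinuousLinearMap.isPositive_def']
  refine ⟨hA.neg, fun x => ?_⟩
  have h0 : RCLike.re (inner ℂ (A x) x) ≤ 0 := by
    refine ge_of_tendsto (x := 𝓝[>] (0 : ℝ)) (f := fun ε : ℝ => ε * ‖x‖ ^ 2) ?_ ?_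
    · exact ((continuous_id.mul continuous_const).tendsto' 0 0 (by simp)).mono_left
        nhdsWithin_le_nhds
    · filter_upwards [self_mem_nhdsWithin] with ε hε using key ε hε x
  rw [ContinuousLinearMap.reApplyInnerSelf_apply, neg_apply, inner_neg_left,
    map_neg]
  linarith

/-- A self-adjoint intertwiner of an irreducible representation having `0` as an approximate
eigenvalue vanishes. -/
theorem IsIrreducible.eq_zero_of_tendsto (hT : T.IsIrreducible) {A : H →L[ℂ] H}
    (hA : IsSelfAdjoint A) (hc : ∀ g, Commute A (T.op g)) {v : ℕ → H} (hv : ∀ n, ‖v n‖ = 1)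
    (hlim : Tendsto (fun n => A (v n)) atTop (𝓝 0)) : A = 0 := by
  refine le_antisymm (hT.nonpos_of_tendsto hA hc hv hlim) (neg_nonpos.1 ?_)
  exact hT.nonpos_of_tendsto hA.neg (fun g => (hc g).neg_left) hv (by simpa using hlim.neg)

/-- Conjugation by `T g` permutes the finite set of operators `T (d * a * d⁻¹)`, so
`∑ (U - 1)* (U - 1)` over this set is an intertwiner; it annihilates the approximate fixed point in
the limit, hence vanishes, and with it every summand. -/
theorem IsIrreducible.op_eq_one_of_finite_conj (hT : T.IsIrreducible)
    (hw : T.WeaklyContainsTrivial) {a : G}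
    (hfin : (Set.range fun d : G => T.toHom (d * a * d⁻¹)).Finite) : T.op a = 1 := by
  obtain ⟨v, hv, hlim⟩ := hw
  set F := hfin.toFinset with hF
  have hmem : ∀ u, u ∈ F ↔ ∃ d : G, T.toHom (d * a * d⁻¹) = u := by simp [hF]
  set f : unitary (H →L[ℂ] H) → (H →L[ℂ] H) :=
    fun u => star ((u : H →L[ℂ] H) - 1) * ((u : H →L[ℂ] H) - 1) with hf
  have hinv : ∀ g u, u ∈ F → MulAut.conj (T.toHom g) u ∈ F := by
    intro g u hu
    obtain ⟨d, rfl⟩ := (hmem u).1 hu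
    exact (hmem _).2 ⟨g * d, by simp [mul_assoc]⟩
  have hcomm : ∀ g, Commute (∑ u ∈ F, f u) (T.op g) := by
    intro g
    rw [Commute, SemiconjBy, Finset.sum_mul, Finset.mul_sum, eq_comm]
    refine Finset.sum_nbij' (MulAut.conj (T.toHom g)) (MulAut.conj (T.toHom g⁻¹))
      (hinv g) (hinv g⁻¹) (fun u _ => by simp [mul_assoc]) (fun u _ => by simp [mul_assoc]) ?_
    intro u _
    have h1 : star (T.op g) * T.op g = 1 := Unitary.coe_star_mul_self (T.toHom g)
    have h2 : T.op g * star (T.op g) = 1 := Unitary.coe_mul_star_self (T.toHom g)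
    have h3 : ((MulAut.conj (T.toHom g) u : unitary (H →L[ℂ] H)) : H →L[ℂ] H) - 1
        = T.op g * ((u : H →L[ℂ] H) - 1) * star (T.op g) := by
      rw [mul_sub, sub_mul, mul_one, h2]; rfl
    simp only [hf, h3, star_mul, star_star, mul_assoc, h1, mul_one]
    rw [← mul_assoc (star (T.op g)) (T.op g), h1, one_mul]
  have hzero : ∑ u ∈ F, f u = 0 := by
    refine hT.eq_zero_of_tendsto ?_ hcomm hv ?_
    · exact isSelfAdjoint_sum _ fun u _ => IsSelfAdjoint.star_mul_self _
    · simp only [sum_apply]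
      rw [← Finset.sum_const_zero (s := F)]
      refine tendsto_finsetSum _ fun u hu => ?_
      obtain ⟨d, rfl⟩ := (hmem u).1 hu
      have h1 := tendsto_zero_iff_norm_tendsto_zero.2 (hlim (d * a * d⁻¹))
      have h2 := ((star (T.op (d * a * d⁻¹) - 1)).continuous.tendsto 0).comp h1
      rw [map_zero] at h2
      exact h2
  have ha : T.toHom a ∈ F := (hmem _).2 ⟨1, by simp⟩
  have hfa : f (T.toHom a) = 0 :=
    (Finset.sum_eq_zero_iff_of_nonneg fun u _ => star_mul_self_nonneg _).1 hzero _ ha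
  exact sub_eq_zero.1 (CStarRing.star_mul_self_eq_zero_iff _ |>.1 hfa)

/-- If `T (d * a * d⁻¹)` is unchanged when `d` is multiplied on the right by an element of a
subgroup of finite index, these operators form a finite set. -/
lemma finite_range_conj {M : Subgroup G} [M.FiniteIndex] {a : G}
    (h : ∀ m ∈ M, T.toHom (m * a * m⁻¹) = T.toHom a) :
    (Set.range fun d : G => T.toHom (d * a * d⁻¹)).Finite := by
  have hlift : ∀ d e : G, QuotientGroup.leftRel M d e →
      T.toHom (d * a * d⁻¹) = T.toHom (e * a * e⁻¹) := by
    intro d e hde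
    have h1 := h _ (QuotientGroup.leftRel_apply.1 hde)
    rw [show e * a * e⁻¹ = d * (d⁻¹ * e * a * (d⁻¹ * e)⁻¹) * d⁻¹ by group]
    rw [map_mul, map_mul, map_mul T.toHom _ d⁻¹, map_mul T.toHom d _, h1]
  have : Finite (G ⧸ M) := inferInstance
  refine (Set.finite_range (ι := G ⧸ M)
    (Quotient.lift (fun d : G => T.toHom (d * a * d⁻¹)) hlift)).subset ?_
  rintro _ ⟨d, rfl⟩
  exact ⟨Quotient.mk _ d, rfl⟩

theorem IsIrreducible.isTrivial_of_isVirtuallyNilpotent (hT : T.IsIrreducible)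
    (hw : T.WeaklyContainsTrivial) (hG : Group.IsVirtuallyNilpotent G) : T.IsTrivial := by
  obtain ⟨M, hM, hfin⟩ := hG
  have hseries : ∀ n : ℕ, ∀ x ∈ Subgroup.upperCentralSeries M n, T.toHom x = 1 := by
    intro n
    induction n with
    | zero => intro x hx; simp_all
    | succ n ih =>
      intro x hx
      refine op_eq_one_iff.1 (hT.op_eq_one_of_finite_conj hw
        (finite_range_conj (M := M) fun m hm => ?_))
      -- `T x` commutes with `T m` since `T` kills the commutator of `x` and `m`.
      have h1 := ih _ (Subgroup.mem_upperCentralSeries_succ_iff.1 hx ⟨m, hm⟩)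
      have h2 : T.toHom x * T.toHom m = T.toHom m * T.toHom x := by
        simpa [commutatorElement_def, mul_inv_eq_iff_eq_mul] using h1
      rw [map_mul, map_mul, ← h2, map_inv, mul_inv_cancel_right]
  have hMtriv : ∀ m ∈ M, T.toHom m = 1 := fun m hm => by
    obtain ⟨n, hn⟩ := hM.nilpotent'
    exact hseries n ⟨m, hm⟩ (hn ▸ Subgroup.mem_top _)
  intro g v
  -- `T` is trivial on `M`, so the hypothesis of `finite_range_conj` holds for every element.
  have h1 : T.op g = 1 := hT.op_eq_one_of_finite_conj hw
    (finite_range_conj (M := M) fun m hm => by simp [hMtriv m hm])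
  simp [h1]

end UnitaryRep

theorem mainTheorem2 (G : Type u) [Group G] [TopologicalSpace G] [IsTopologicalGroup G]
    [LocallyCompactSpace G] [SigmaCompactSpace G] [TopologicalSpace.MetrizableSpace G]
    (hG : Group.IsVirtuallyNilpotent G) :
    IdentityExcluding.{u, v} G := by
  rintro H _ _ _ T hT hnon ⟨D, hD, hw⟩
  obtain ⟨N, hN, hfin⟩ := hG
  have hDvn : Group.IsVirtuallyNilpotent D := by
    refine ⟨N.subgroupOf D, Subgroup.isNilpotent_of_ker_le_center (D.subtype.subgroupComap N)
      (fun x hx => ?_), inferInstance⟩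
    have hx' : ((x : D) : G) = 1 := congrArg (fun z : N => (z : G)) hx
    rw [show x = 1 from Subtype.ext (Subtype.ext hx')]
    exact one_mem _
  have htriv := (hT.restrict_of_dense hD).isTrivial_of_isVirtuallyNilpotent hw hDvn
  refine hnon fun g v => ?_
  have hclosed : IsClosed {g : G | T.op g v = v} :=
    isClosed_eq (T.continuous_orbit v) continuous_const
  exact hclosed.closure_subset_iff.2 (fun d hd => htriv ⟨d, hd⟩ v) (hD g)
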